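/- Let $(M^n,g)$ be a Hermitian manifold, that is, a complex manifold of complex dimension $n$ with complex structure $J$ and a smooth Riemannian metric $g=\langle\,,\rangle$ such that $\langle Ju,Jv\rangle=\langle u,v\rangle$. Let $\nabla$ be the Riemannian (Levi-Civita) connection and $\nabla^h$ the Hermitian (Chern) connection of $g$, let $R$, $R^h$ be their curvature tensors, with the convention $R_{uvwx}=\langle R(u,v)w,x\rangle$, $R(u,v)=[\nabla_u,\nabla_v]-\nabla_{[u,v]}$ (and likewise for $R^h$), and let $T^h(u,v)=\nabla^h_uv-\nabla^h_vu-[u,v]$ be the torsion of $\nabla^h$. Extend $\langle\,,\rangle$, $R$, $R^h$, $T^h$ complex multilinearly to the complexified tangent spaces, and let $T^{1,0}_pM$ be the space of vectors of the form $v-\sqrt{-1}Jv$ with $v$ a real tangent vector at $p$. For $X,Y,Z\in T^{1,0}_pM$ put $$T^X_{YZ}=\tfrac12\langle T^h(Y,Z),\overline X\rangle ,$$ and, for a unitary frame $e_1,\dots,e_n$ of $T^{1,0}_pM$ (i.e. $\langle e_i,\overline{e_j}\rangle=\delta_{ij}$), write an index $k$ for $e_k$, so that $T^k_{XY}=T^{e_k}_{XY}$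 and $T^X_{kY}=T^X_{e_kY}$. **Theorem.** For all $p\in M$, all $X,Y\in T^{1,0}_pM$ and every unitary frame $e_1,\dots,e_n$ of $T^{1,0}_pM$, $$\tfrac12\bigl(R^h_{X\overline XY\overline Y}+R^h_{Y\overline YX\overline X}\bigr)-R_{X\overline YY\overline X}=\sum_{k=1}^n\Bigl\{|T^k_{XY}|^2+2\,\mathrm{Re}\bigl(T^Y_{kY}\overline{T^X_{kX}}\bigr)\Bigr\},$$ $$\mathrm{Re}\,R^h_{X\overline YY\overline X}-R_{X\overline XY\overline Y}=\sum_{k=1}^n\Bigl\{|T^Y_{kX}|^2+|T^X_{kY}|^2-|T^k_{XY}|^2\Bigr\}.$$ In particular, $$R^h_{X\overline XX\overline X}-R_{X\overline XX\overline X}=2\sum_{k=1}^n|T^X_{kX}|^2\ \ge 0 .$$ Moreover, if $R^h_{X\overline XX\overline X}=R_{X\overline XX\overline X}$ for all $p\in M$ and all $X\in T^{1,0}_pM$, then $T^h=0$; and this equality holds everywhere if and only if $g$ is Kähler (i.e. the form $\omega(u,v)=\langle Ju,v\rangle$ is closed). -/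

import Mathlib

open scoped Manifold ContDiff TensorProduct

noncomputable section

/-- A complex manifold is in particular a smooth real manifold. -/
instance isManifold_real_of_complex {E : Type*} [NormedAddCommGroup E] [NormedSpace ℂ E]
    {M : Type*} [TopologicalSpace M] [ChartedSpace E M] [IsManifold 𝓘(ℂ, E) ∞ M] :
    IsManifold 𝓘(ℝ, E) ∞ M := by
  apply isManifold_of_contDiffOn
  intro e e' he he'
  have h := (contDiffGroupoid ∞ 𝓘(ℂ, E)).compatible he he'
  rw [contDiffGroupoid, mem_groupoid_of_pregroupoid] at h
  have h1 : ContDiffOn ℂ ∞ _ _ := h.1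
  simpa using h1.restrict_scalars ℝ

namespace HermitianGeometry

/-! ### Connections on an open set of a complex vector space

`E` is a complex normed space. A metric on an open subset of `E` is a function
`G : E → E →L[ℝ] E →L[ℝ] ℝ`, the almost complex structure is multiplication by `Complex.I`.
A connection `∇` on the tangent bundle of the open set is given by its connection form
`A : E → E →L[ℝ] E →L[ℝ] E`, through `∇_u s = D_u s + A z u s`. -/

section Local

variable {E : Type*} [NormedAddCommGroup E] [NormedSpace ℂ E]

/-- Multiplication by `√-1`, as a real linear map. -/
def mulI (E : Type*) [NormedAddCommGroup E] [NormedSpace ℂ E] : E →L[ℝ] E :=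
  (Complex.I • ContinuousLinearMap.id ℂ E).restrictScalars ℝ

/-- Connection form of the Levi-Civita connection of `G`: the vector `A z u v` is determined by
the Koszul formula
`G(A u v, w) = ½ (∂_u G(v, w) + ∂_v G(u, w) - ∂_w G(u, v))`.
As `G z` is nondegenerate, `(G z).inverse` is the inverse of `v ↦ G z v ·`. -/
def leviCivitaForm (G : E → E →L[ℝ] E →L[ℝ] ℝ) (z u v : E) : E :=
  (G z).inverse ((1 / 2 : ℝ) •
    (fderiv ℝ G z u v + fderiv ℝ G z v u - ((fderiv ℝ G z).flip u).flip v))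

/-- Connection form of the Hermitian (Chern) connection of the `J`-invariant metric `G`.
With the Hermitian form `H(v, w) = G(v, w) + √-1 G(v, J w)`, which is complex linear in `v`, and
`∂_u = ½ (D_u - √-1 D_{J u})`, the vector `A z u v` is determined by `H(A u v, w) = ∂_u H(v, w)`
(that is, `θ = ∂g g⁻¹` in the holomorphic coordinate frame), whose real part reads
`G(A u v, w) = ½ (D_u G(v, w) + D_{J u} G(v, J w))`. -/
def chernForm (G : E → E →L[ℝ] E →L[ℝ] ℝ) (z u v : E) : E :=
  (G z).inverse ((1 / 2 : ℝ) •
    (fderiv ℝ G z u v + (fderiv ℝ G z (mulI E u) v).comp (mulI E)))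

/-- `R(u, v) w = ∇_u ∇_v w - ∇_v ∇_u w` for constant vector fields `u, v, w`, where
`∇ = D + A`. -/
def curvatureOfForm (A : E → E → E → E) (z u v w : E) : E :=
  fderiv ℝ (fun y => A y v w) z u - fderiv ℝ (fun y => A y u w) z v
    + A z u (A z v w) - A z v (A z u w)

/-- `T(u, v) = ∇_u v - ∇_v u` for constant vector fields `u, v`, where `∇ = D + A`. -/
def torsionOfForm (A : E → E → E → E) (z u v : E) : E :=
  A z u v - A z v u

end Local

/-! ### The complexification of a real vector space -/

section Complexification

variable {V : Type*} [AddCommGroup V] [Module ℝ V]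

/-- The real part of `v + √-1 w`. -/
def rePart : ℂ ⊗[ℝ] V →ₗ[ℝ] V :=
  (TensorProduct.lid ℝ V).toLinearMap ∘ₗ LinearMap.rTensor V Complex.reLm

/-- The imaginary part of `v + √-1 w`. -/
def imPart : ℂ ⊗[ℝ] V →ₗ[ℝ] V :=
  (TensorProduct.lid ℝ V).toLinearMap ∘ₗ LinearMap.rTensor V Complex.imLm

/-- Complex conjugation `v + √-1 w ↦ v - √-1 w`. -/
def conjC : ℂ ⊗[ℝ] V →ₗ[ℝ] ℂ ⊗[ℝ] V :=
  LinearMap.rTensor V Complex.conjAe.toLinearMap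

/-- The complex linear extension of a real linear map `f : V → ℂ`. -/
def cext (f : V → ℂ) (X : ℂ ⊗[ℝ] V) : ℂ :=
  f (rePart X) + Complex.I * f (imPart X)

/-- The complex bilinear extension of a real bilinear form. -/
def cext₂ (f : V → V → ℝ) (X Y : ℂ ⊗[ℝ] V) : ℂ :=
  cext (fun x => cext (fun y => (f x y : ℂ)) Y) X

/-- The complex trilinear extension of a real trilinear form. -/
def cext₃ (f : V → V → V → ℝ) (X Y Z : ℂ ⊗[ℝ] V) : ℂ :=
  cext (fun x => cext₂ (f x) Y Z) X

/-- The complex quadrilinear extension of a real quadrilinear form. -/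
def cext₄ (f : V → V → V → V → ℝ) (X Y Z W : ℂ ⊗[ℝ] V) : ℂ :=
  cext (fun x => cext₃ (f x) Y Z W) X

end Complexification

/-! ### Hermitian manifolds -/

section Manifold

variable {E : Type*} [NormedAddCommGroup E] [NormedSpace ℂ E]
  {M : Type*} [TopologicalSpace M] [ChartedSpace E M]

/-- The almost complex structure of a complex manifold. The tangent space at `p` is the model
space `E`, via the derivative of the preferred chart at `p`, which is holomorphic. -/
def J (p : M) : TangentSpace 𝓘(ℝ, E) p →L[ℝ] TangentSpace 𝓘(ℝ, E) p :=
  mulI E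

/-- The type `(1,0)` tangent vectors at `p`: those of the form `v - √-1 J v` with `v` real. -/
def T10 (p : M) : Set (ℂ ⊗[ℝ] TangentSpace 𝓘(ℝ, E) p) :=
  {X | ∃ v : TangentSpace 𝓘(ℝ, E) p, X = 1 ⊗ₜ[ℝ] v - Complex.I ⊗ₜ[ℝ] (J p v)}

variable (E M) in
/-- A Hermitian metric on a complex manifold: a smooth Riemannian metric such that `J` is
orthogonal. -/
structure HermitianMetric [IsManifold 𝓘(ℂ, E) ∞ M] extends
    Bundle.ContMDiffRiemannianMetric 𝓘(ℝ, E) ∞ E (fun p : M => TangentSpace 𝓘(ℝ, E) p) where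
  inner_J : ∀ (p : M) (u v : TangentSpace 𝓘(ℝ, E) p), inner p (J p u) (J p v) = inner p u v

variable [IsManifold 𝓘(ℂ, E) ∞ M] (g : HermitianMetric E M)

/-- The expression of the metric in the preferred chart `φ` at `p`, that is, its pullback under
`φ⁻¹`. -/
def localMetric (p : M) (z : E) : E →L[ℝ] E →L[ℝ] ℝ :=
  let D : E →L[ℝ] E := mfderiv 𝓘(ℝ, E) 𝓘(ℝ, E) (chartAt E p).symm z
  let B : E →L[ℝ] E →L[ℝ] ℝ := g.inner ((chartAt E p).symm z)
  B.bilinearComp D D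

/-- The Riemannian curvature tensor `R_{uvwx} = ⟨R(u, v) w, x⟩` at `p`, for the Levi-Civita
connection. -/
def riemannCurvature (p : M) (u v w x : TangentSpace 𝓘(ℝ, E) p) : ℝ :=
  g.inner p (curvatureOfForm (E := E) (leviCivitaForm (localMetric g p)) (chartAt E p p) u v w) x

/-- The Hermitian curvature tensor `R^h_{uvwx} = ⟨R^h(u, v) w, x⟩` at `p`, for the Hermitian
(Chern) connection. -/
def chernCurvature (p : M) (u v w x : TangentSpace 𝓘(ℝ, E) p) : ℝ :=
  g.inner p (curvatureOfForm (E := E) (chernForm (localMetric g p)) (chartAt E p p) u v w) x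

/-- The torsion `T^h(u, v) = ∇^h_u v - ∇^h_v u - [u, v]` at `p` of the Hermitian (Chern)
connection. -/
def chernTorsion (p : M) (u v : TangentSpace 𝓘(ℝ, E) p) : TangentSpace 𝓘(ℝ, E) p :=
  torsionOfForm (E := E) (chernForm (localMetric g p)) (chartAt E p p) u v

/-- `⟨X, Y⟩`, extended complex bilinearly. -/
def innerC (p : M) (X Y : ℂ ⊗[ℝ] TangentSpace 𝓘(ℝ, E) p) : ℂ :=
  cext₂ (fun u v => g.inner p u v) X Y

/-- `R_{XYZW}`, extended complex multilinearly. -/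
def R (p : M) (X Y Z W : ℂ ⊗[ℝ] TangentSpace 𝓘(ℝ, E) p) : ℂ :=
  cext₄ (riemannCurvature g p) X Y Z W

/-- `R^h_{XYZW}`, extended complex multilinearly. -/
def Rh (p : M) (X Y Z W : ℂ ⊗[ℝ] TangentSpace 𝓘(ℝ, E) p) : ℂ :=
  cext₄ (chernCurvature g p) X Y Z W

/-- `T^X_{YZ} = ½ ⟨T^h(Y, Z), X̄⟩`. In a unitary frame `e` with dual coframe `φ`, the torsion
forms are `τ_i = ∑_{j,k} T^i_{jk} φ_j ∧ φ_k` with `T^i_{jk}` skew in `j, k`, so that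
`T^h(e_j, e_k) = 2 ∑_i T^i_{jk} e_i`, and `T^X_{YZ} = ∑ T^i_{jk} X̄_i Y_j Z_k`. -/
def torsionCoeff (p : M) (X Y Z : ℂ ⊗[ℝ] TangentSpace 𝓘(ℝ, E) p) : ℂ :=
  (1 / 2) * cext₃ (fun u v w => g.inner p (chernTorsion g p u v) w) Y Z (conjC X)

/-- A unitary frame of the type `(1,0)` tangent space at `p`, whose dimension is
`n = dim_ℂ M`. -/
structure IsUnitaryFrame (p : M)
    (e : Fin (Module.finrank ℂ E) → ℂ ⊗[ℝ] TangentSpace 𝓘(ℝ, E) p) : Prop where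
  mem : ∀ i, e i ∈ T10 p
  inner_eq : ∀ i j, innerC g p (e i) (conjC (e j)) = if i = j then 1 else 0

/-- `g` is Kähler: its fundamental form `ω(u, v) = g(J u, v)` is closed. In a holomorphic chart,
`dω(u, v, w) = D_u ω(v, w) + D_v ω(w, u) + D_w ω(u, v)` for constant vector fields. -/
def IsKahler : Prop :=
  ∀ (p : M) (u v w : E),
    let om : E → E → E → ℝ := fun z a b => localMetric g p z (mulI E a) b
    fderiv ℝ (fun z => om z v w) (chartAt E p p) u
      + fderiv ℝ (fun z => om z w u) (chartAt E p p) v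
      + fderiv ℝ (fun z => om z u v) (chartAt E p p) w = 0

end Manifold

end HermitianGeometry

end

noncomputable section

set_option maxSynthPendingDepth 3

namespace HermitianGeometry

/-! ### Hermitian inner products on a complex vector space. -/

section Pointwise

variable {E : Type*} [NormedAddCommGroup E] [NormedSpace ℂ E]

/-! Everything is computed at one point in a holomorphic chart. There the Chern form `C` is complex
bilinear, and the Levi-Civita form is its symmetrisation plus a correction of mixed type: `L(u,v) =
½(C(u,v) + C(v,u)) + P(u,v) + P(v,u)`. Here `P`, the `contorsion`, is conjugate linear in `u`,
complex linear in `v`, and minus half an adjoint of the torsion: `G(P(u,v),x) = -½ G(T(x,u),v)`.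

Both curvatures are second derivatives of the metric plus quadratic terms in the connection form. On
vectors of types (1,0), (0,1), (1,0), (0,1) the second derivatives enter only through
`mixedHessian`, and the quadratic terms are Hermitian products of values of `C` and of `P`
(`cext₄_curvature_chernForm`, `cext₄_curvature_leviCivitaForm`). In the combinations of the theorem
the Hessians cancel. The `C` terms combine by a polarisation identity into `±2|T(X,Y)|²`, and the
`P` terms remain. Parseval's identity in the unitary frame (`sum_hermForm_mul_conj`) turns these
norms and products into the sums over `k`.

On the diagonal the difference is `16 |P(v,v)|²`. If it vanishes, `G(T(x,v),w)` is skew in `v, w`,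
which is incompatible with complex bilinearity of `T` unless `T = 0`; and `T = 0` is the Kähler
condition. -/

@[simp]
theorem mulI_apply (v : E) : mulI E v = Complex.I • v := rfl

theorem mulI_mulI (v : E) : mulI E (mulI E v) = -v := by
  simp [smul_smul]

/-- A Hermitian inner product on a complex vector space, given by its real part. -/
structure IsHermitianInner (g : E →L[ℝ] E →L[ℝ] ℝ) : Prop where
  symm : ∀ u v, g u v = g v u
  inv : ∀ u v, g (mulI E u) (mulI E v) = g u v
  pos : ∀ u, u ≠ 0 → 0 < g u u

end Pointwise

/-! ### The metric read in the preferred chart. -/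

section LocalMetric

open Filter Topology Bundle

variable {E : Type*} [NormedAddCommGroup E] [NormedSpace ℂ E]
  {M : Type*} [TopologicalSpace M] [ChartedSpace E M] [IsManifold 𝓘(ℂ, E) ∞ M]

theorem mfderiv_chartAt_symm_eq_fderiv (p : M) {z : E} (hz : z ∈ (chartAt E p).target) :
    (mfderiv 𝓘(ℝ, E) 𝓘(ℝ, E) (chartAt E p).symm z : E →L[ℝ] E) =
      fderiv ℝ (chartAt E ((chartAt E p).symm z) ∘ (chartAt E p).symm) z := by
  have h : MDifferentiableAt 𝓘(ℝ, E) 𝓘(ℝ, E) (chartAt E p).symm z :=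
    mdifferentiableAt_atlas_symm (I := 𝓘(ℝ, E)) (chart_mem_atlas E p) hz
  unfold mfderiv
  refine (if_pos h).trans ?_
  simp only [writtenInExtChartAt, mfld_simps, fderivWithin_univ]
  rfl

/-- The derivative is that of a transition map between two charts. Transition maps are holomorphic,
so their real derivative is complex linear. -/
theorem mfderiv_chartAt_symm_mulI (p : M) {z : E} (hz : z ∈ (chartAt E p).target) (v : E) :
    (mfderiv 𝓘(ℝ, E) 𝓘(ℝ, E) (chartAt E p).symm z : E →L[ℝ] E) (mulI E v) =
      mulI E ((mfderiv 𝓘(ℝ, E) 𝓘(ℝ, E) (chartAt E p).symm z : E →L[ℝ] E) v) := by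
  rw [mfderiv_chartAt_symm_eq_fderiv p hz]
  set q := (chartAt E p).symm z
  have h := (contDiffGroupoid ∞ 𝓘(ℂ, E)).compatible (chart_mem_atlas E p) (chart_mem_atlas E q)
  rw [contDiffGroupoid, mem_groupoid_of_pregroupoid] at h
  have h1 : ContDiffOn ℂ ∞ _ _ := h.1
  have hmem : z ∈ ((chartAt E p).symm ≫ₕ chartAt E q).source := by
    simp [hz, q]
  have h2 : ContDiffOn ℂ ∞ (chartAt E q ∘ (chartAt E p).symm)
      ((chartAt E p).symm ≫ₕ chartAt E q).source := by
    simpa using h1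
  have h3 : DifferentiableAt ℂ (chartAt E q ∘ (chartAt E p).symm) z :=
    (h2.contDiffAt (((chartAt E p).symm ≫ₕ chartAt E q).open_source.mem_nhds hmem)).differentiableAt
      (by simp)
  rw [h3.fderiv_restrictScalars ℝ]
  exact (fderiv ℂ (chartAt E q ∘ (chartAt E p).symm) z : E →L[ℂ] E).map_smul Complex.I v

theorem mfderiv_chartAt_symm_self (p : M) :
    (mfderiv 𝓘(ℝ, E) 𝓘(ℝ, E) (chartAt E p).symm (chartAt E p p) : E →L[ℝ] E) =
      ContinuousLinearMap.id ℝ E := by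
  rw [mfderiv_chartAt_symm_eq_fderiv p (mem_chart_target E p)]
  rw [(chartAt E p).left_inv (mem_chart_source E p)]
  have : (chartAt E p ∘ (chartAt E p).symm) =ᶠ[𝓝 (chartAt E p p)] id := by
    filter_upwards [(chartAt E p).open_target.mem_nhds (mem_chart_target E p)] with z hz
    exact (chartAt E p).right_inv hz
  rw [this.fderiv_eq, fderiv_id]

variable (g : HermitianMetric E M)

theorem localMetric_apply (p : M) (z u v : E) :
    localMetric g p z u v = (g.inner ((chartAt E p).symm z) : E →L[ℝ] E →L[ℝ] ℝ)
      ((mfderiv 𝓘(ℝ, E) 𝓘(ℝ, E) (chartAt E p).symm z : E →L[ℝ] E) u)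
      ((mfderiv 𝓘(ℝ, E) 𝓘(ℝ, E) (chartAt E p).symm z : E →L[ℝ] E) v) := rfl

theorem localMetric_self (p : M) :
    localMetric g p (chartAt E p p) = (g.inner p : E →L[ℝ] E →L[ℝ] ℝ) := by
  ext u v
  rw [localMetric_apply, mfderiv_chartAt_symm_self, (chartAt E p).left_inv (mem_chart_source E p)]
  rfl

theorem localMetric_symm (p : M) (z u v : E) :
    localMetric g p z u v = localMetric g p z v u := by
  rw [localMetric_apply, localMetric_apply]
  exact g.symm ((chartAt E p).symm z) _ _

theorem localMetric_mulI (p : M) {z : E} (hz : z ∈ (chartAt E p).target) (u v : E) :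
    localMetric g p z (mulI E u) (mulI E v) = localMetric g p z u v := by
  simp only [localMetric_apply, mfderiv_chartAt_symm_mulI p hz]
  exact g.inner_J _ _ _

theorem isHermitianInner_localMetric_self (p : M) :
    IsHermitianInner (localMetric g p (chartAt E p p)) where
  symm := localMetric_symm g p _
  inv := localMetric_mulI g p (mem_chart_target E p)
  pos u hu := by
    rw [localMetric_self]
    exact g.pos p u hu

/-- Smoothness of `g` is a statement about its expression in the bundle trivialization; this
identification carries it over to `localMetric`. -/
theorem localMetric_eq_inCoordinates (p : M) {z : E} (hz : z ∈ (chartAt E p).target) :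
    localMetric g p z = ContinuousLinearMap.inCoordinates E (TangentSpace 𝓘(ℝ, E))
      (E →L[ℝ] ℝ) (fun q : M => TangentSpace 𝓘(ℝ, E) q →L[ℝ] ℝ) p ((chartAt E p).symm z) p
      ((chartAt E p).symm z) (g.inner ((chartAt E p).symm z)) := by
  have hq : (chartAt E p).symm z ∈ (chartAt E p).source := (chartAt E p).map_target hz
  have key : ∀ v : E, (mfderiv 𝓘(ℝ, E) 𝓘(ℝ, E) (chartAt E p).symm z : E →L[ℝ] E) v =
      (trivializationAt E (TangentSpace 𝓘(ℝ, E)) p).symm ((chartAt E p).symm z) v := by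
    intro v
    have := TangentBundle.symmL_trivializationAt (I := 𝓘(ℝ, E)) (𝕜 := ℝ) hq
    have hz' : extChartAt 𝓘(ℝ, E) p ((chartAt E p).symm z) = z := by simp [hz]
    rw [hz'] at this
    simp only [mfld_simps, mfderivWithin_univ] at this
    rw [← Trivialization.symmL_apply (R := ℝ) _ (by simpa using hq), this]
    rfl
  ext u v
  have h2 := inCoordinates_apply_eq₂ (𝕜 := ℝ) (F₁ := E) (F₂ := E) (F₃ := ℝ)
    (E₁ := fun q : M => TangentSpace 𝓘(ℝ, E) q)
    (E₂ := fun q : M => TangentSpace 𝓘(ℝ, E) q) (E₃ := Bundle.Trivial M ℝ)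
    (x₀ := p) (x := (chartAt E p).symm z) (ϕ := g.inner ((chartAt E p).symm z)) (v := u) (w := v)
    (by simpa using hq) (by simpa using hq) (by simp)
  refine Eq.trans ?_ h2.symm
  rw [localMetric_apply, key, key]
  simp

theorem contDiffAt_localMetric (p : M) :
    ContDiffAt ℝ ∞ (localMetric g p) (chartAt E p p) := by
  have h1 := (contMDiffAt_hom_bundle _).1 (g.contMDiff.contMDiffAt (x := p))
  have h2 := h1.2
  have h3 : ContMDiffAt 𝓘(ℝ, E) 𝓘(ℝ, E) ∞ (chartAt E p).symm (chartAt E p p) :=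
    contMDiffOn_chart_symm.contMDiffAt
      ((chartAt E p).open_target.mem_nhds (mem_chart_target E p))
  have h4 := ContMDiffAt.comp_of_eq (x := chartAt E p p) h2 h3
    ((chartAt E p).left_inv (mem_chart_source E p))
  rw [contMDiffAt_iff_contDiffAt] at h4
  refine h4.congr_of_eventuallyEq ?_
  filter_upwards [(chartAt E p).open_target.mem_nhds (mem_chart_target E p)] with z hz
  exact localMetric_eq_inCoordinates g p hz

end LocalMetric

/-! ### First and second derivatives of the metric, and curvature formulas. -/

section LocalAnalysis

open Filter Topology

variable {E : Type*} [NormedAddCommGroup E] [NormedSpace ℂ E]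

theorem two_le_infty : (2 : WithTop ℕ∞) ≤ ∞ :=
  WithTop.coe_le_coe.2 (le_top : (2 : ℕ∞) ≤ ⊤)

/-- `G` is a smooth symmetric tensor, `J`-invariant near `z₀` and positive definite at `z₀`. -/
structure IsHermitianNear (G : E → E →L[ℝ] E →L[ℝ] ℝ) (z₀ : E) : Prop where
  contDiffAt : ContDiffAt ℝ ∞ G z₀
  symm : ∀ z u v, G z u v = G z v u
  inv : ∀ᶠ z in 𝓝 z₀, ∀ u v, G z (mulI E u) (mulI E v) = G z u v
  pos : ∀ u, u ≠ 0 → 0 < G z₀ u u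

variable {G : E → E →L[ℝ] E →L[ℝ] ℝ} {z₀ : E}

theorem fderiv_bilin_apply {z : E} (h : DifferentiableAt ℝ G z) (u v w : E) :
    fderiv ℝ (fun z => G z v w) z u = fderiv ℝ G z u v w := by
  have h1 := ((h.hasFDerivAt.clm_apply (hasFDerivAt_const v z)).clm_apply
    (hasFDerivAt_const w z)).fderiv
  rw [h1]
  simp

theorem fderiv_trilin_apply {Q : E → E →L[ℝ] E →L[ℝ] E →L[ℝ] ℝ} (h : DifferentiableAt ℝ Q z₀)
    (u v w x : E) : fderiv ℝ (fun z => Q z v w x) z₀ u = fderiv ℝ Q z₀ u v w x := by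
  have h1 := (((h.hasFDerivAt.clm_apply (hasFDerivAt_const v z₀)).clm_apply
    (hasFDerivAt_const w z₀)).clm_apply (hasFDerivAt_const x z₀)).fderiv
  rw [h1]
  simp

namespace IsHermitianNear

theorem isHermitianInner (h : IsHermitianNear G z₀) : IsHermitianInner (G z₀) :=
  ⟨h.symm z₀, h.inv.self_of_nhds, h.pos⟩

theorem differentiableAt (h : IsHermitianNear G z₀) : DifferentiableAt ℝ G z₀ :=
  h.contDiffAt.differentiableAt (by simp)

theorem eventually_differentiableAt (h : IsHermitianNear G z₀) :
    ∀ᶠ z in 𝓝 z₀, DifferentiableAt ℝ G z := by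
  have h1 : ContDiffAt ℝ 1 G z₀ := h.contDiffAt.of_le (by simp)
  filter_upwards [h1.eventually (by simp)] with z hz
  exact hz.differentiableAt (by simp)

theorem differentiableAt_fderiv (h : IsHermitianNear G z₀) :
    DifferentiableAt ℝ (fderiv ℝ G) z₀ :=
  (h.contDiffAt.fderiv_right (m := 1) (by simpa [one_add_one_eq_two] using two_le_infty)).differentiableAt (by simp)

/-- Holds on a neighbourhood, not only at `z₀`, so that it can be differentiated once more. -/
theorem eventually_fderiv_symm (h : IsHermitianNear G z₀) :
    ∀ᶠ z in 𝓝 z₀, ∀ u v w, fderiv ℝ G z u v w = fderiv ℝ G z u w v := by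
  filter_upwards [h.eventually_differentiableAt] with z hz u v w
  rw [← fderiv_bilin_apply hz, ← fderiv_bilin_apply hz]
  simp only [h.symm _ v w]

theorem eventually_fderiv_inv (h : IsHermitianNear G z₀) :
    ∀ᶠ z in 𝓝 z₀, ∀ u v w, fderiv ℝ G z u (mulI E v) (mulI E w) = fderiv ℝ G z u v w := by
  filter_upwards [h.eventually_differentiableAt, eventually_eventually_nhds.2 h.inv]
    with z hz hz' u v w
  rw [← fderiv_bilin_apply hz, ← fderiv_bilin_apply hz]
  have : (fun z => G z (mulI E v) (mulI E w)) =ᶠ[𝓝 z] fun z => G z v w := by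
    filter_upwards [hz'] with y hy using hy v w
  rw [this.fderiv_eq]

theorem fderiv_symm (h : IsHermitianNear G z₀) (u v w : E) :
    fderiv ℝ G z₀ u v w = fderiv ℝ G z₀ u w v :=
  h.eventually_fderiv_symm.self_of_nhds u v w

theorem fderiv_inv (h : IsHermitianNear G z₀) (u v w : E) :
    fderiv ℝ G z₀ u (mulI E v) (mulI E w) = fderiv ℝ G z₀ u v w :=
  h.eventually_fderiv_inv.self_of_nhds u v w

theorem fderiv_fderiv_symm (h : IsHermitianNear G z₀) (u v w x : E) :
    fderiv ℝ (fderiv ℝ G) z₀ u v w x = fderiv ℝ (fderiv ℝ G) z₀ u v x w := by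
  rw [← fderiv_trilin_apply h.differentiableAt_fderiv,
    ← fderiv_trilin_apply h.differentiableAt_fderiv]
  have : (fun z => fderiv ℝ G z v w x) =ᶠ[𝓝 z₀] fun z => fderiv ℝ G z v x w := by
    filter_upwards [h.eventually_fderiv_symm] with y hy using hy v w x
  rw [this.fderiv_eq]

theorem fderiv_fderiv_inv (h : IsHermitianNear G z₀) (u v w x : E) :
    fderiv ℝ (fderiv ℝ G) z₀ u v (mulI E w) (mulI E x) =
      fderiv ℝ (fderiv ℝ G) z₀ u v w x := by
  rw [← fderiv_trilin_apply h.differentiableAt_fderiv,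
    ← fderiv_trilin_apply h.differentiableAt_fderiv]
  have : (fun z => fderiv ℝ G z v (mulI E w) (mulI E x)) =ᶠ[𝓝 z₀]
      fun z => fderiv ℝ G z v w x := by
    filter_upwards [h.eventually_fderiv_inv] with y hy using hy v w x
  rw [this.fderiv_eq]

theorem fderiv_fderiv_swap (h : IsHermitianNear G z₀) (u v : E) :
    fderiv ℝ (fderiv ℝ G) z₀ u v = fderiv ℝ (fderiv ℝ G) z₀ v u :=
  (h.contDiffAt.isSymmSndFDerivAt (by simpa using two_le_infty)) u v

end IsHermitianNear

/-- The curvature of a metric connection in terms of the first order expression `K` for its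
connection form. -/
theorem inner_curvatureOfForm {A : E → E → E → E} {K : E → E → E → E → ℝ}
    (hG : DifferentiableAt ℝ G z₀) 
    (hA : ∀ v w, DifferentiableAt ℝ (fun z => A z v w) z₀)
    (hK : ∀ v w x, ∀ᶠ z in 𝓝 z₀, G z (A z v w) x = K z v w x)
    (hmetric : ∀ u a x, fderiv ℝ G z₀ u a x = G z₀ (A z₀ u a) x + G z₀ a (A z₀ u x))
    (u v w x : E) :
    G z₀ (curvatureOfForm A z₀ u v w) x =
      fderiv ℝ (fun z => K z v w x) z₀ u - fderiv ℝ (fun z => K z u w x) z₀ v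
        - G z₀ (A z₀ v w) (A z₀ u x) + G z₀ (A z₀ u w) (A z₀ v x) := by
  -- The product rule for `G(A v w, x) = K v w x` trades the derivative of `A` for those of `K` and
  -- `G`; by `hmetric` the latter yields `G(A u (A v w), x)`, which cancels the quadratic term of
  -- the curvature.
  have key : ∀ u v, G z₀ (fderiv ℝ (fun z => A z v w) z₀ u) x =
      fderiv ℝ (fun z => K z v w x) z₀ u - fderiv ℝ G z₀ u (A z₀ v w) x := by
    intro u v
    have h1 : (fun z => G z (A z v w) x) =ᶠ[𝓝 z₀] fun z => K z v w x := hK v w x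
    rw [← h1.fderiv_eq, ((hG.hasFDerivAt.clm_apply (hA v w).hasFDerivAt).clm_apply
      (hasFDerivAt_const x z₀)).fderiv]
    simp
  simp only [curvatureOfForm, map_sub, map_add, add_apply,
    sub_apply, key, hmetric]
  ring

variable [FiniteDimensional ℂ E]

namespace IsHermitianInner

variable {g : E →L[ℝ] E →L[ℝ] ℝ}

theorem isInvertible (h : IsHermitianInner g) : g.IsInvertible := by
  have : FiniteDimensional ℝ E := FiniteDimensional.complexToReal E
  have hinj : Function.Injective g := by
    rw [injective_iff_map_eq_zero]
    intro u hu
    by_contra hne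
    have := h.pos u hne
    simp [hu] at this
  have hfr : Module.finrank ℝ E = Module.finrank ℝ (E →L[ℝ] ℝ) := by
    rw [← LinearMap.toContinuousLinearMap.finrank_eq]
    exact (Subspace.dual_finrank_eq (K := ℝ) (V := E)).symm
  let e := (LinearEquiv.ofInjectiveOfFinrankEq g.toLinearMap hinj hfr).toContinuousLinearEquiv
  exact ⟨e, by ext; rfl⟩

end IsHermitianInner

/-- Invertible operators form an open set, so nondegeneracy at `z₀` persists nearby. -/
theorem IsHermitianNear.eventually_apply_inverse (h : IsHermitianNear G z₀) :
    ∀ᶠ z in 𝓝 z₀, ∀ φ, G z ((G z).inverse φ) = φ := by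
  have : FiniteDimensional ℝ E := FiniteDimensional.complexToReal E
  have : CompleteSpace E := FiniteDimensional.complete ℝ E
  obtain ⟨e, he⟩ := h.isHermitianInner.isInvertible
  have h1 := h.contDiffAt.continuousAt.eventually (he ▸ e.nhds)
  filter_upwards [h1] with z ⟨e', he'⟩ φ
  rw [← he']
  simp

theorem IsHermitianNear.differentiableAt_inverse_apply (h : IsHermitianNear G z₀)
    {α : E → E →L[ℝ] ℝ} (hα : DifferentiableAt ℝ α z₀) :
    DifferentiableAt ℝ (fun z => (G z).inverse (α z)) z₀ := by
  have : FiniteDimensional ℝ E := FiniteDimensional.complexToReal E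
  have : CompleteSpace E := FiniteDimensional.complete ℝ E
  obtain ⟨e, he⟩ := h.isHermitianInner.isInvertible
  have h1 : DifferentiableAt ℝ ContinuousLinearMap.inverse (G z₀) :=
    (he ▸ contDiffAt_map_inverse e (n := 1)).differentiableAt (by simp)
  have h2 : DifferentiableAt ℝ (fun z => (G z).inverse) z₀ := h1.comp z₀ h.differentiableAt
  exact h2.clm_apply hα

theorem IsHermitianNear.eventually_inner_chernForm (h : IsHermitianNear G z₀) :
    ∀ᶠ z in 𝓝 z₀, ∀ u v w, G z (chernForm G z u v) w =
      (1 / 2) * (fderiv ℝ G z u v w + fderiv ℝ G z (mulI E u) v (mulI E w)) := by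
  filter_upwards [h.eventually_apply_inverse] with z hz u v w
  rw [chernForm, hz]
  simp
  ring

theorem IsHermitianNear.eventually_inner_leviCivitaForm (h : IsHermitianNear G z₀) :
    ∀ᶠ z in 𝓝 z₀, ∀ u v w, G z (leviCivitaForm G z u v) w =
      (1 / 2) * (fderiv ℝ G z u v w + fderiv ℝ G z v u w - fderiv ℝ G z w u v) := by
  filter_upwards [h.eventually_apply_inverse] with z hz u v w
  rw [leviCivitaForm, hz]
  simp

theorem IsHermitianNear.inner_curvature_chernForm (h : IsHermitianNear G z₀) (u v w x : E) :
    G z₀ (curvatureOfForm (chernForm G) z₀ u v w) x =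
      (1 / 2) * (fderiv ℝ (fderiv ℝ G) z₀ u (mulI E v) w (mulI E x)
        - fderiv ℝ (fderiv ℝ G) z₀ v (mulI E u) w (mulI E x))
        - G z₀ (chernForm G z₀ v w) (chernForm G z₀ u x)
        + G z₀ (chernForm G z₀ u w) (chernForm G z₀ v x) := by
  have hQ := h.differentiableAt_fderiv
  have hd : ∀ v w x, DifferentiableAt ℝ (fun z => fderiv ℝ G z v w x) z₀ := fun v w x =>
    ((hQ.clm_apply (differentiableAt_const v)).clm_apply (differentiableAt_const w)).clm_apply
      (differentiableAt_const x)
  rw [inner_curvatureOfForm (K := fun z u v w =>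
    (1 / 2) * (fderiv ℝ G z u v w + fderiv ℝ G z (mulI E u) v (mulI E w)))
    h.differentiableAt]
  · have key : ∀ u v, fderiv ℝ (fun z => (1 / 2) * (fderiv ℝ G z v w x
        + fderiv ℝ G z (mulI E v) w (mulI E x))) z₀ u =
        (1 / 2) * (fderiv ℝ (fderiv ℝ G) z₀ u v w x
          + fderiv ℝ (fderiv ℝ G) z₀ u (mulI E v) w (mulI E x)) := by
      intro u v
      rw [← fderiv_trilin_apply hQ, ← fderiv_trilin_apply hQ,
        (((hd v w x).hasFDerivAt.fun_add (hd (mulI E v) w (mulI E x)).hasFDerivAt).const_mul (1 / 2 : ℝ)).fderiv]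
      rfl
    -- Second derivatives along `u, v` without `J` are symmetric and cancel.
    rw [key, key, h.fderiv_fderiv_swap v u]
    ring
  · intro v w
    apply h.differentiableAt_inverse_apply
    fun_prop
  · intro v w x
    filter_upwards [h.eventually_inner_chernForm] with z hz using hz v w x
  -- Metric compatibility: the derivatives along `J u` cancel by `J`-invariance of `G`.
  · intro u a x
    have hi := h.eventually_inner_chernForm.self_of_nhds
    rw [h.symm z₀ a, hi, hi, h.fderiv_symm u x a, h.fderiv_symm _ x (mulI E a)]
    have := h.fderiv_inv (mulI E u) a (mulI E x)
    rw [mulI_mulI, map_neg] at this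
    linarith

theorem IsHermitianNear.inner_curvature_leviCivitaForm (h : IsHermitianNear G z₀) (u v w x : E) :
    G z₀ (curvatureOfForm (leviCivitaForm G) z₀ u v w) x =
      (1 / 2) * (fderiv ℝ (fderiv ℝ G) z₀ u w v x - fderiv ℝ (fderiv ℝ G) z₀ u x v w
        - fderiv ℝ (fderiv ℝ G) z₀ v w u x + fderiv ℝ (fderiv ℝ G) z₀ v x u w)
        - G z₀ (leviCivitaForm G z₀ v w) (leviCivitaForm G z₀ u x)
        + G z₀ (leviCivitaForm G z₀ u w) (leviCivitaForm G z₀ v x) := by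
  have hQ := h.differentiableAt_fderiv
  have hd : ∀ v w x, DifferentiableAt ℝ (fun z => fderiv ℝ G z v w x) z₀ := fun v w x =>
    ((hQ.clm_apply (differentiableAt_const v)).clm_apply (differentiableAt_const w)).clm_apply
      (differentiableAt_const x)
  rw [inner_curvatureOfForm (K := fun z u v w =>
    (1 / 2) * (fderiv ℝ G z u v w + fderiv ℝ G z v u w - fderiv ℝ G z w u v))
    h.differentiableAt]
  · have key : ∀ u v, fderiv ℝ (fun z => (1 / 2) * (fderiv ℝ G z v w x
        + fderiv ℝ G z w v x - fderiv ℝ G z x v w)) z₀ u =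
        (1 / 2) * (fderiv ℝ (fderiv ℝ G) z₀ u v w x + fderiv ℝ (fderiv ℝ G) z₀ u w v x
          - fderiv ℝ (fderiv ℝ G) z₀ u x v w) := by
      intro u v
      rw [← fderiv_trilin_apply hQ, ← fderiv_trilin_apply hQ, ← fderiv_trilin_apply hQ,
        ((((hd v w x).hasFDerivAt.fun_add (hd w v x).hasFDerivAt).fun_sub
          (hd x v w).hasFDerivAt).const_mul (1 / 2 : ℝ)).fderiv]
      rfl
    rw [key, key, h.fderiv_fderiv_swap v u]
    ring
  · intro v w
    apply h.differentiableAt_inverse_apply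
    have : DifferentiableAt ℝ (fun z => ((fderiv ℝ G z).flip v).flip w) z₀ := by
      have h1 := ((ContinuousLinearMap.flipₗᵢ ℝ E E (E →L[ℝ] ℝ)).differentiableAt).comp z₀ hQ
      have h2 : DifferentiableAt ℝ (fun z => (fderiv ℝ G z).flip v) z₀ :=
        h1.clm_apply (differentiableAt_const v)
      have h3 := ((ContinuousLinearMap.flipₗᵢ ℝ E E ℝ).differentiableAt).comp z₀ h2
      exact h3.clm_apply (differentiableAt_const w)
    fun_prop
  · intro v w x
    filter_upwards [h.eventually_inner_leviCivitaForm] with z hz using hz v w x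
  · intro u a x
    have hi := h.eventually_inner_leviCivitaForm.self_of_nhds
    rw [h.symm z₀ a, hi, hi, h.fderiv_symm u x a]
    ring

end LocalAnalysis

/-! ### The Levi-Civita form as symmetrised Chern form plus contorsion. -/

section Contorsion

variable {E : Type*} [NormedAddCommGroup E] [NormedSpace ℂ E]

namespace IsHermitianInner

variable {g : E →L[ℝ] E →L[ℝ] ℝ}

theorem mulI_left (h : IsHermitianInner g) (u v : E) : g (mulI E u) v = -g u (mulI E v) := by
  have := h.inv u (mulI E v)
  rw [mulI_mulI, map_neg] at this
  linarith

theorem mulI_self (h : IsHermitianInner g) (u : E) : g u (mulI E u) = 0 := by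
  have := h.mulI_left u u
  rw [h.symm] at this
  linarith

theorem ext_inner (h : IsHermitianInner g) {u v : E} (huv : ∀ x, g u x = g v x) : u = v := by
  by_contra hne
  have h1 := h.pos (u - v) (sub_ne_zero.2 hne)
  rw [map_sub g, sub_apply, huv, sub_self] at h1
  exact lt_irrefl _ h1

end IsHermitianInner

/-- The mixed type part of the difference of the Levi-Civita connection and the Chern connection;
it is conjugate linear in `u` and complex linear in `v`. -/
def contorsion (G : E → E →L[ℝ] E →L[ℝ] ℝ) (z u v : E) : E :=
  (1 / 2 : ℝ) • (leviCivitaForm G z u v - (1 / 2 : ℝ) • (chernForm G z u v + chernForm G z v u)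
    + mulI E (leviCivitaForm G z (mulI E u) v
      - (1 / 2 : ℝ) • (chernForm G z (mulI E u) v + chernForm G z v (mulI E u))))

namespace IsHermitianNear

variable {G : E → E →L[ℝ] E →L[ℝ] ℝ} {z₀ : E}

theorem fderiv_mulI_left (h : IsHermitianNear G z₀) (u v w : E) :
    fderiv ℝ G z₀ u (mulI E v) w = -fderiv ℝ G z₀ u v (mulI E w) := by
  have := h.fderiv_inv u v (mulI E w)
  rw [mulI_mulI, map_neg] at this
  linarith

theorem fderiv_fderiv_mulI_left (h : IsHermitianNear G z₀) (u v w x : E) :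
    fderiv ℝ (fderiv ℝ G) z₀ u v (mulI E w) x =
      -fderiv ℝ (fderiv ℝ G) z₀ u v w (mulI E x) := by
  have := h.fderiv_fderiv_inv u v w (mulI E x)
  rw [mulI_mulI, map_neg] at this
  linarith

variable [FiniteDimensional ℂ E]

theorem inner_chernForm (h : IsHermitianNear G z₀) (u v w : E) :
    G z₀ (chernForm G z₀ u v) w =
      (1 / 2) * (fderiv ℝ G z₀ u v w + fderiv ℝ G z₀ (mulI E u) v (mulI E w)) :=
  h.eventually_inner_chernForm.self_of_nhds u v w

theorem inner_leviCivitaForm (h : IsHermitianNear G z₀) (u v w : E) :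
    G z₀ (leviCivitaForm G z₀ u v) w =
      (1 / 2) * (fderiv ℝ G z₀ u v w + fderiv ℝ G z₀ v u w - fderiv ℝ G z₀ w u v) :=
  h.eventually_inner_leviCivitaForm.self_of_nhds u v w

theorem fderiv_eq_inner_chernForm (h : IsHermitianNear G z₀) (u v w : E) :
    fderiv ℝ G z₀ u v w = G z₀ (chernForm G z₀ u v) w + G z₀ v (chernForm G z₀ u w) := by
  rw [h.symm z₀ v, h.inner_chernForm, h.inner_chernForm, h.fderiv_symm u w v,
    h.fderiv_symm _ w (mulI E v), h.fderiv_mulI_left]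
  ring

theorem chernForm_mulI_left (h : IsHermitianNear G z₀) (u v : E) :
    chernForm G z₀ (mulI E u) v = mulI E (chernForm G z₀ u v) := by
  refine h.isHermitianInner.ext_inner fun x => ?_
  rw [h.isHermitianInner.mulI_left, h.inner_chernForm, h.inner_chernForm, mulI_mulI, mulI_mulI]
  simp only [map_neg, neg_apply]
  ring

theorem chernForm_mulI_right (h : IsHermitianNear G z₀) (u v : E) :
    chernForm G z₀ u (mulI E v) = mulI E (chernForm G z₀ u v) := by
  refine h.isHermitianInner.ext_inner fun x => ?_
  rw [h.isHermitianInner.mulI_left, h.inner_chernForm, h.inner_chernForm, mulI_mulI,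
    h.fderiv_mulI_left, h.fderiv_inv]
  simp only [map_neg]
  ring

theorem chernForm_neg_left (h : IsHermitianNear G z₀) (u v : E) :
    chernForm G z₀ (-u) v = -chernForm G z₀ u v := by
  rw [← mulI_mulI, h.chernForm_mulI_left, h.chernForm_mulI_left, mulI_mulI]

theorem chernForm_neg_right (h : IsHermitianNear G z₀) (u v : E) :
    chernForm G z₀ u (-v) = -chernForm G z₀ u v := by
  rw [← mulI_mulI, h.chernForm_mulI_right, h.chernForm_mulI_right, mulI_mulI]

theorem leviCivitaForm_symm (h : IsHermitianNear G z₀) (u v : E) :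
    leviCivitaForm G z₀ u v = leviCivitaForm G z₀ v u := by
  refine h.isHermitianInner.ext_inner fun x => ?_
  rw [h.inner_leviCivitaForm, h.inner_leviCivitaForm, h.fderiv_symm x u v]
  ring

theorem torsionOfForm_mulI_left (h : IsHermitianNear G z₀) (u v : E) :
    torsionOfForm (chernForm G) z₀ (mulI E u) v = mulI E (torsionOfForm (chernForm G) z₀ u v) := by
  simp only [torsionOfForm, h.chernForm_mulI_left, h.chernForm_mulI_right, map_sub]

theorem torsionOfForm_mulI_right (h : IsHermitianNear G z₀) (u v : E) :
    torsionOfForm (chernForm G) z₀ u (mulI E v) = mulI E (torsionOfForm (chernForm G) z₀ u v) := by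
  simp only [torsionOfForm, h.chernForm_mulI_left, h.chernForm_mulI_right, map_sub]

theorem torsionOfForm_neg_left (h : IsHermitianNear G z₀) (u v : E) :
    torsionOfForm (chernForm G) z₀ (-u) v = -torsionOfForm (chernForm G) z₀ u v := by
  simp only [torsionOfForm, h.chernForm_neg_left, h.chernForm_neg_right, neg_sub_neg, neg_sub]

theorem torsionOfForm_neg_right (h : IsHermitianNear G z₀) (u v : E) :
    torsionOfForm (chernForm G) z₀ u (-v) = -torsionOfForm (chernForm G) z₀ u v := by
  simp only [torsionOfForm, h.chernForm_neg_left, h.chernForm_neg_right, neg_sub_neg, neg_sub]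

/-- Substituting metric compatibility of the Chern connection into the Koszul formula leaves, beyond
the symmetrisation, only differences `C(x,·) - C(·,x)`. -/
theorem inner_leviCivitaForm_sub (h : IsHermitianNear G z₀) (u v x : E) :
    G z₀ (leviCivitaForm G z₀ u v - (1 / 2 : ℝ) • (chernForm G z₀ u v + chernForm G z₀ v u)) x =
      -(1 / 2) * (G z₀ (torsionOfForm (chernForm G) z₀ x u) v
        + G z₀ (torsionOfForm (chernForm G) z₀ x v) u) := by
  simp only [map_sub, sub_apply, h.inner_leviCivitaForm, map_smul, smul_apply, map_add, add_apply,
    smul_eq_mul, torsionOfForm, h.fderiv_eq_inner_chernForm]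
  rw [h.symm z₀ v (chernForm G z₀ u x), h.symm z₀ u (chernForm G z₀ v x),
    h.symm z₀ u (chernForm G z₀ x v)]
  ring

/-- Projecting to the part conjugate linear in `u` keeps `G(T(x,u),v)` and kills `G(T(x,v),u)`,
because `T` is complex bilinear. -/
theorem inner_contorsion (h : IsHermitianNear G z₀) (u v x : E) :
    G z₀ (contorsion G z₀ u v) x =
      -(1 / 2) * G z₀ (torsionOfForm (chernForm G) z₀ x u) v := by
  have hg := h.isHermitianInner
  rw [contorsion, map_smul, smul_apply, map_add, add_apply, hg.mulI_left,
    h.inner_leviCivitaForm_sub, h.inner_leviCivitaForm_sub]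
  simp only [h.torsionOfForm_mulI_left, h.torsionOfForm_mulI_right, hg.inv, mulI_mulI, map_neg,
    neg_apply, smul_eq_mul]
  ring

theorem contorsion_mulI_left (h : IsHermitianNear G z₀) (u v : E) :
    contorsion G z₀ (mulI E u) v = -mulI E (contorsion G z₀ u v) := by
  refine h.isHermitianInner.ext_inner fun x => ?_
  rw [map_neg, neg_apply, h.isHermitianInner.mulI_left, h.inner_contorsion, h.inner_contorsion,
    h.torsionOfForm_mulI_left, h.torsionOfForm_mulI_right, neg_neg]

theorem contorsion_mulI_right (h : IsHermitianNear G z₀) (u v : E) :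
    contorsion G z₀ u (mulI E v) = mulI E (contorsion G z₀ u v) := by
  refine h.isHermitianInner.ext_inner fun x => ?_
  rw [h.isHermitianInner.mulI_left, h.inner_contorsion, h.inner_contorsion,
    h.torsionOfForm_mulI_left, h.isHermitianInner.mulI_left]
  ring

theorem leviCivitaForm_eq (h : IsHermitianNear G z₀) (u v : E) :
    leviCivitaForm G z₀ u v = (1 / 2 : ℝ) • (chernForm G z₀ u v + chernForm G z₀ v u)
      + (contorsion G z₀ u v + contorsion G z₀ v u) := by
  rw [← sub_eq_iff_eq_add']
  refine h.isHermitianInner.ext_inner fun x => ?_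
  rw [h.inner_leviCivitaForm_sub, map_add, add_apply, h.inner_contorsion, h.inner_contorsion]
  ring

end IsHermitianNear

end Contorsion

/-! ### Multilinear extensions evaluated on vectors of pure type. -/

section Complexification

variable {V : Type*} [AddCommGroup V] [Module ℝ V]

theorem rePart_sub (v w : V) : rePart (1 ⊗ₜ[ℝ] v - Complex.I ⊗ₜ[ℝ] w) = v := by
  simp [rePart]

theorem imPart_sub (v w : V) : imPart (1 ⊗ₜ[ℝ] v - Complex.I ⊗ₜ[ℝ] w) = -w := by
  simp [imPart]

theorem rePart_conjC (X : ℂ ⊗[ℝ] V) : rePart (conjC X) = rePart X := by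
  induction X with
  | zero => simp
  | tmul z v => simp [rePart, conjC]
  | add x y hx hy => simp only [map_add, hx, hy]

theorem imPart_conjC (X : ℂ ⊗[ℝ] V) : imPart (conjC X) = -imPart X := by
  induction X with
  | zero => simp
  | tmul z v => simp [imPart, conjC]
  | add x y hx hy => simp only [map_add, hx, hy, neg_add]

variable (j : V → V)

/-- The complex multilinear extension of a quadrilinear form on vectors of types
`(1,0), (0,1), (1,0), (0,1)`. -/
theorem cext₄_sub_conjC (f : V → V → V → V → ℝ)
    (h1 : ∀ u v w x, f (-u) v w x = -f u v w x) (h3 : ∀ u v w x, f u v (-w) x = -f u v w x)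
    (v w a b : V) :
    cext₄ f (1 ⊗ₜ v - Complex.I ⊗ₜ j v) (conjC (1 ⊗ₜ w - Complex.I ⊗ₜ j w))
        (1 ⊗ₜ a - Complex.I ⊗ₜ j a) (conjC (1 ⊗ₜ b - Complex.I ⊗ₜ j b)) =
      ((f v w a b + f (j v) (j w) a b - f (j v) w (j a) b + f (j v) w a (j b) + f v (j w) (j a) b
        - f v (j w) a (j b) + f v w (j a) (j b) + f (j v) (j w) (j a) (j b) : ℝ) : ℂ)
      + Complex.I * ((-f (j v) w a b + f v (j w) a b - f v w (j a) b + f v w a (j b)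
        - f (j v) (j w) (j a) b + f (j v) (j w) a (j b) - f (j v) w (j a) (j b)
        + f v (j w) (j a) (j b) : ℝ) : ℂ) := by
  simp only [cext₄, cext₃, cext₂, cext, rePart_conjC, imPart_conjC, rePart_sub, imPart_sub, neg_neg,
    h1, h3]
  apply Complex.ext
  · simp
    ring
  · simp
    ring

/-- Oddness is needed only in the two (1,0) arguments: their imaginary parts are `-j v` and `-j w`,
while conjugation makes that of the third `j a`. -/
theorem cext₃_sub_conjC (f : V → V → V → ℝ)
    (h1 : ∀ u v w, f (-u) v w = -f u v w) (h2 : ∀ u v w, f u (-v) w = -f u v w) (v w a : V) :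
    cext₃ f (1 ⊗ₜ v - Complex.I ⊗ₜ j v) (1 ⊗ₜ w - Complex.I ⊗ₜ j w)
        (conjC (1 ⊗ₜ a - Complex.I ⊗ₜ j a)) =
      ((f v w a - f (j v) (j w) a + f (j v) w (j a) + f v (j w) (j a) : ℝ) : ℂ)
      + Complex.I * ((f v w (j a) - f (j v) w a - f v (j w) a - f (j v) (j w) (j a) : ℝ) : ℂ) := by
  simp only [cext₃, cext₂, cext, rePart_conjC, imPart_conjC, rePart_sub, imPart_sub, neg_neg,
    h1, h2]
  apply Complex.ext
  · simp
    ring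
  · simp
    ring

theorem cext₂_sub_conjC (f : V → V → ℝ) (h1 : ∀ u v, f (-u) v = -f u v) (v w : V) :
    cext₂ f (1 ⊗ₜ v - Complex.I ⊗ₜ j v) (conjC (1 ⊗ₜ w - Complex.I ⊗ₜ j w)) =
      ((f v w + f (j v) (j w) : ℝ) : ℂ) + Complex.I * ((f v (j w) - f (j v) w : ℝ) : ℂ) := by
  simp only [cext₂, cext, rePart_conjC, imPart_conjC, rePart_sub, imPart_sub, neg_neg, h1]
  apply Complex.ext
  · simp
  · simp
    ring

end Complexification

/-! ### The Hermitian form of the metric and Parseval's identity. -/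

section HermForm

variable {E : Type*} [NormedAddCommGroup E] [NormedSpace ℂ E]

/-- The Hermitian form with real part `g`, complex linear in the first variable. -/
def hermForm (g : E →L[ℝ] E →L[ℝ] ℝ) (u v : E) : ℂ :=
  (g u v : ℂ) + Complex.I * (g u (mulI E v) : ℂ)

namespace IsHermitianInner

variable {g : E →L[ℝ] E →L[ℝ] ℝ}

theorem hermForm_self (h : IsHermitianInner g) (u : E) : hermForm g u u = (g u u : ℂ) := by
  simp only [hermForm, h.mulI_self, Complex.ofReal_zero, mul_zero, add_zero]

theorem conj_hermForm (h : IsHermitianInner g) (u v : E) :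
    starRingEnd ℂ (hermForm g u v) = hermForm g v u := by
  have h1 := h.mulI_left u v
  rw [h.symm] at h1
  simp only [hermForm, h1, h.symm v u]
  simp

theorem hermForm_add_left (u v w : E) : hermForm g (u + v) w = hermForm g u w + hermForm g v w := by
  simp only [hermForm, map_add, add_apply]
  push_cast
  ring

theorem hermForm_add_right (u v w : E) :
    hermForm g u (v + w) = hermForm g u v + hermForm g u w := by
  simp only [hermForm, map_add]
  push_cast
  ring

theorem hermForm_sub_left (u v w : E) : hermForm g (u - v) w = hermForm g u w - hermForm g v w := by
  simp only [hermForm, map_sub, sub_apply]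
  push_cast
  ring

theorem hermForm_sub_right (u v w : E) :
    hermForm g u (v - w) = hermForm g u v - hermForm g u w := by
  simp only [hermForm, map_sub]
  push_cast
  ring

theorem hermForm_real_smul_left (r : ℝ) (u v : E) :
    hermForm g (r • u) v = r * hermForm g u v := by
  simp only [hermForm, map_smul, smul_apply, smul_eq_mul]
  push_cast
  ring

theorem hermForm_real_smul_right (r : ℝ) (u v : E) :
    hermForm g u (r • v) = r * hermForm g u v := by
  simp only [hermForm, map_smul, smul_eq_mul]
  push_cast
  ring

theorem hermForm_smul_left (h : IsHermitianInner g) (c : ℂ) (u v : E) :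
    hermForm g (c • u) v = c * hermForm g u v := by
  have hc : c • u = c.re • u + c.im • mulI E u := by
    rw [mulI_apply]
    conv_lhs => rw [← Complex.re_add_im c, add_smul, mul_smul]
    rfl
  have hI : hermForm g (mulI E u) v = Complex.I * hermForm g u v := by
    simp only [hermForm, h.mulI_left, mulI_mulI, map_neg]
    push_cast
    linear_combination (-(g u (mulI E v) : ℂ)) * Complex.I_sq
  rw [hc, hermForm_add_left, hermForm_real_smul_left, hermForm_real_smul_left, hI]
  conv_rhs => rw [← Complex.re_add_im c]
  ring

theorem hermForm_sum_left {ι : Type*} (s : Finset ι) (f : ι → E) (v : E) :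
    hermForm g (∑ i ∈ s, f i) v = ∑ i ∈ s, hermForm g (f i) v := by
  classical
  induction s using Finset.induction_on with
  | empty => simp [hermForm]
  | insert i s hi ih => rw [Finset.sum_insert hi, Finset.sum_insert hi, hermForm_add_left, ih]

/-- Parseval's identity for a frame of vectors of squared length `1 / 2`. -/
theorem sum_hermForm_mul_conj [FiniteDimensional ℂ E] (h : IsHermitianInner g)
    {f : Fin (Module.finrank ℂ E) → E}
    (hf : ∀ i j, hermForm g (f i) (f j) = if i = j then 1 / 2 else 0) (u v : E) :
    ∑ k, hermForm g (f k) u * starRingEnd ℂ (hermForm g (f k) v) = 1 / 2 * hermForm g v u := by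
  have hcomb : ∀ (c : Fin (Module.finrank ℂ E) → ℂ) (k),
      hermForm g (∑ i, c i • f i) (f k) = 1 / 2 * c k := by
    intro c k
    rw [hermForm_sum_left]
    simp [h.hermForm_smul_left, hf, mul_comm]
  -- Orthogonality gives independence, and `finrank ℂ E` independent vectors form a basis, so `v`
  -- expands in `f`.
  have hli : LinearIndependent ℂ f := by
    rw [Fintype.linearIndependent_iff]
    intro c hc k
    have := hcomb c k
    rw [hc] at this
    simpa [hermForm] using this
  let b := basisOfLinearIndependentOfCardEqFinrank' f hli (by simp)
  have hv : v = ∑ i, b.repr v i • f i := by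
    conv_lhs => rw [← b.sum_repr v]
    simp [b]
  conv_rhs => rw [hv, hermForm_sum_left, Finset.mul_sum]
  refine Finset.sum_congr rfl fun k _ => ?_
  rw [h.conj_hermForm, h.hermForm_smul_left]
  conv_lhs => rw [hv, hcomb]
  ring

end IsHermitianInner

end HermForm

/-! ### Both curvatures on vectors of types (1,0), (0,1), (1,0), (0,1). -/

section Curvature

variable {E : Type*} [NormedAddCommGroup E] [NormedSpace ℂ E]

/-- The second derivative `∂_V ∂_W̄ G(A, B̄)` of the coefficients of the metric, for the vectors
`V = v - √-1 J v` and so on. -/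
def mixedHessian (G : E → E →L[ℝ] E →L[ℝ] ℝ) (z v w a b : E) : ℂ :=
  ((2 * (fderiv ℝ (fderiv ℝ G) z v w a b + fderiv ℝ (fderiv ℝ G) z (mulI E v) (mulI E w) a b
    + fderiv ℝ (fderiv ℝ G) z w (mulI E v) a (mulI E b)
    - fderiv ℝ (fderiv ℝ G) z v (mulI E w) a (mulI E b)) : ℝ) : ℂ)
  + Complex.I * ((2 * (fderiv ℝ (fderiv ℝ G) z v w a (mulI E b)
    + fderiv ℝ (fderiv ℝ G) z (mulI E v) (mulI E w) a (mulI E b)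
    + fderiv ℝ (fderiv ℝ G) z v (mulI E w) a b
    - fderiv ℝ (fderiv ℝ G) z (mulI E v) w a b) : ℝ) : ℂ)

namespace IsHermitianNear

variable {G : E → E →L[ℝ] E →L[ℝ] ℝ} {z₀ : E}

/-- The metric is real and second derivatives commute, so conjugation only exchanges barred and
unbarred vectors. It handles the real part in the second identity. -/
theorem conj_mixedHessian (h : IsHermitianNear G z₀) (v w a b : E) :
    starRingEnd ℂ (mixedHessian G z₀ v w a b) = mixedHessian G z₀ w v b a := by
  simp only [mixedHessian, h.fderiv_fderiv_symm _ _ b, h.fderiv_fderiv_mulI_left,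
    h.fderiv_fderiv_swap w v, h.fderiv_fderiv_swap (mulI E w) (mulI E v),
    h.fderiv_fderiv_swap (mulI E w) v, h.fderiv_fderiv_swap w (mulI E v)]
  apply Complex.ext
  · simp
    ring
  · simp
    ring

variable [FiniteDimensional ℂ E]

/-- The Chern curvature `R^h(V, W̄, A, B̄)`. -/
theorem cext₄_curvature_chernForm (h : IsHermitianNear G z₀) (v w a b : E) :
    cext₄ (fun u v w x => G z₀ (curvatureOfForm (chernForm G) z₀ u v w) x)
        (1 ⊗ₜ v - Complex.I ⊗ₜ mulI E v) (conjC (1 ⊗ₜ w - Complex.I ⊗ₜ mulI E w))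
        (1 ⊗ₜ a - Complex.I ⊗ₜ mulI E a) (conjC (1 ⊗ₜ b - Complex.I ⊗ₜ mulI E b)) =
      -mixedHessian G z₀ v w a b
        + 8 * hermForm (G z₀) (chernForm G z₀ v a) (chernForm G z₀ w b) := by
  have hg := h.isHermitianInner
  rw [cext₄_sub_conjC (mulI E)]
  · simp only [h.inner_curvature_chernForm, h.chernForm_mulI_left, h.chernForm_mulI_right,
      mulI_mulI, map_neg, neg_apply, h.fderiv_fderiv_inv, h.fderiv_fderiv_mulI_left, hg.inv,
      hg.mulI_left, h.fderiv_fderiv_swap w v, h.fderiv_fderiv_swap (mulI E w) (mulI E v),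
      h.fderiv_fderiv_swap (mulI E w) v, h.fderiv_fderiv_swap w (mulI E v), mixedHessian, hermForm]
    push_cast
    ring
  · intro u v w x
    simp only [h.inner_curvature_chernForm, h.chernForm_neg_left, map_neg, neg_apply]
    ring
  · intro u v w x
    simp only [h.inner_curvature_chernForm, h.chernForm_neg_right, map_neg, neg_apply]
    ring

theorem leviCivitaForm_neg_left (h : IsHermitianNear G z₀) (u v : E) :
    leviCivitaForm G z₀ (-u) v = -leviCivitaForm G z₀ u v := by
  refine h.isHermitianInner.ext_inner fun x => ?_
  simp only [h.inner_leviCivitaForm, map_neg, neg_apply]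
  ring

theorem leviCivitaForm_neg_right (h : IsHermitianNear G z₀) (u v : E) :
    leviCivitaForm G z₀ u (-v) = -leviCivitaForm G z₀ u v := by
  rw [h.leviCivitaForm_symm, h.leviCivitaForm_neg_left, h.leviCivitaForm_symm]

set_option maxHeartbeats 1000000 in
/-- The Riemannian curvature `R(V, W̄, A, B̄)`. -/
theorem cext₄_curvature_leviCivitaForm (h : IsHermitianNear G z₀) (v w a b : E) :
    cext₄ (fun u v w x => G z₀ (curvatureOfForm (leviCivitaForm G) z₀ u v w) x)
        (1 ⊗ₜ v - Complex.I ⊗ₜ mulI E v) (conjC (1 ⊗ₜ w - Complex.I ⊗ₜ mulI E w))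
        (1 ⊗ₜ a - Complex.I ⊗ₜ mulI E a) (conjC (1 ⊗ₜ b - Complex.I ⊗ₜ mulI E b)) =
      -(1 / 2) * (mixedHessian G z₀ v b a w + mixedHessian G z₀ a w v b)
        + 2 * hermForm (G z₀) (chernForm G z₀ v a + chernForm G z₀ a v)
          (chernForm G z₀ w b + chernForm G z₀ b w)
        - 8 * (hermForm (G z₀) (contorsion G z₀ w a) (contorsion G z₀ v b)
          + hermForm (G z₀) (contorsion G z₀ b v) (contorsion G z₀ a w)) := by
  have hg := h.isHermitianInner
  rw [cext₄_sub_conjC (mulI E)]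
  -- From here only types matter: `M` is complex bilinear and `P` is conjugate linear in its first
  -- argument, so both are made opaque and used through these rules.
  · obtain ⟨M, hM⟩ : ∃ M : E → E → E, ∀ u v,
        M u v = (1 / 2 : ℝ) • (chernForm G z₀ u v + chernForm G z₀ v u) := ⟨_, fun _ _ => rfl⟩
    obtain ⟨P, hP⟩ : ∃ P : E → E → E, ∀ u v, P u v = contorsion G z₀ u v := ⟨_, fun _ _ => rfl⟩
    have hL : ∀ u v, leviCivitaForm G z₀ u v = M u v + (P u v + P v u) := fun u v => by
      rw [hM, hP, hP, h.leviCivitaForm_eq]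
    have hM1 : ∀ u v, M (mulI E u) v = mulI E (M u v) := fun u v => by
      simp only [hM, h.chernForm_mulI_left, h.chernForm_mulI_right, map_add, map_smul]
    have hM2 : ∀ u v, M u (mulI E v) = mulI E (M u v) := fun u v => by
      simp only [hM, h.chernForm_mulI_left, h.chernForm_mulI_right, map_add, map_smul]
    have hP1 : ∀ u v, P (mulI E u) v = -mulI E (P u v) := fun u v => by
      rw [hP, hP, h.contorsion_mulI_left]
    have hP2 : ∀ u v, P u (mulI E v) = mulI E (P u v) := fun u v => by
      rw [hP, hP, h.contorsion_mulI_right]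
    have hM3 : ∀ u v, chernForm G z₀ u v + chernForm G z₀ v u = (2 : ℝ) • M u v := fun u v => by
      rw [hM, smul_smul]; norm_num
    -- Orients the last product as `P a w` against `P b v`, the order in which the curvature formula
    -- pairs `L(w,a)` with `L(v,b)`.
    rw [hM3, hM3, ← hg.conj_hermForm (contorsion G z₀ a w)]
    simp only [← hP, IsHermitianInner.hermForm_real_smul_left,
      IsHermitianInner.hermForm_real_smul_right]
    simp only [hermForm, map_add, map_mul, Complex.conj_ofReal, Complex.conj_I]
    simp only [h.inner_curvature_leviCivitaForm, hL, hM1, hM2, hP1, hP2, mulI_mulI, map_add,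
      map_neg, add_apply, neg_apply, hg.inv, hg.mulI_left]
    have hs1 : ∀ x y, fderiv ℝ (fderiv ℝ G) z₀ x y w a = fderiv ℝ (fderiv ℝ G) z₀ x y a w :=
      fun x y => h.fderiv_fderiv_symm x y w a
    have hs2 : ∀ x y, fderiv ℝ (fderiv ℝ G) z₀ x y w (mulI E a) =
        -fderiv ℝ (fderiv ℝ G) z₀ x y a (mulI E w) := fun x y => by
      rw [h.fderiv_fderiv_symm, h.fderiv_fderiv_mulI_left]
    simp only [h.fderiv_fderiv_inv, h.fderiv_fderiv_mulI_left, hs1, hs2, mixedHessian,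
      h.fderiv_fderiv_swap b (mulI E v), h.fderiv_fderiv_swap w (mulI E a),
      h.fderiv_fderiv_swap w a, h.fderiv_fderiv_swap (mulI E w) a,
      h.fderiv_fderiv_swap (mulI E w) (mulI E a)]
    push_cast
    ring
  · intro u v w x
    simp only [h.inner_curvature_leviCivitaForm, h.leviCivitaForm_neg_left, map_neg, neg_apply]
    ring
  · intro u v w x
    simp only [h.inner_curvature_leviCivitaForm, h.leviCivitaForm_neg_right, map_neg, neg_apply]
    ring

end IsHermitianNear

end Curvature

/-! ### Transfer to the manifold, curvature differences and the Kähler condition. -/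

section Assembly

open Filter Topology

variable {E : Type*} [NormedAddCommGroup E] [NormedSpace ℂ E]
  {M : Type*} [TopologicalSpace M] [ChartedSpace E M]

/-- The type `(1,0)` vector `v - √-1 J v`. -/
def typeOneZero (p : M) (v : E) : ℂ ⊗[ℝ] TangentSpace 𝓘(ℝ, E) p :=
  1 ⊗ₜ[ℝ] (v : TangentSpace 𝓘(ℝ, E) p) - Complex.I ⊗ₜ[ℝ] (J p v)

theorem mem_T10_iff (p : M) (X : ℂ ⊗[ℝ] TangentSpace 𝓘(ℝ, E) p) :
    X ∈ T10 p ↔ ∃ v : E, X = typeOneZero p v := Iff.rfl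

variable [IsManifold 𝓘(ℂ, E) ∞ M] (g : HermitianMetric E M)

theorem isHermitianNear_localMetric (p : M) :
    IsHermitianNear (localMetric g p) (chartAt E p p) where
  contDiffAt := contDiffAt_localMetric g p
  symm := localMetric_symm g p
  inv := by
    filter_upwards [(chartAt E p).open_target.mem_nhds (mem_chart_target E p)] with z hz
    exact localMetric_mulI g p hz
  pos := (isHermitianInner_localMetric_self g p).pos

theorem inner_eq_localMetric (p : M) (u v : E) :
    g.inner p u v = localMetric g p (chartAt E p p) u v := by
  rw [localMetric_self]
  rfl

theorem innerC_typeOneZero (p : M) (v w : E) :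
    innerC g p (typeOneZero p v) (conjC (typeOneZero p w)) =
      2 * hermForm (localMetric g p (chartAt E p p)) v w := by
  have hg := (isHermitianNear_localMetric g p).isHermitianInner
  have h1 := cext₂_sub_conjC (mulI E) (fun u v : E => localMetric g p (chartAt E p p) u v)
    (fun u v => by simp) v w
  have h2 : (fun u v : E => localMetric g p (chartAt E p p) u v) =
      fun u v : E => g.inner p u v := by
    funext u v
    exact (inner_eq_localMetric g p u v).symm
  refine Eq.trans (by rw [h2]; rfl) (h1.trans ?_)
  simp only [hg.inv, hg.mulI_left, hermForm]
  push_cast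
  ring

theorem isKahler_iff_fderiv : IsKahler g ↔ ∀ (p : M) (u v w : E),
    fderiv ℝ (localMetric g p) (chartAt E p p) u (mulI E v) w
      + fderiv ℝ (localMetric g p) (chartAt E p p) v (mulI E w) u
      + fderiv ℝ (localMetric g p) (chartAt E p p) w (mulI E u) v = 0 := by
  have hd : ∀ (p : M) (u v w : E),
      fderiv ℝ (fun z => localMetric g p z (mulI E v) w) (chartAt E p p) u =
        fderiv ℝ (localMetric g p) (chartAt E p p) u (mulI E v) w := fun p u v w =>
    fderiv_bilin_apply (isHermitianNear_localMetric g p).differentiableAt _ _ _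
  simp only [IsKahler, hd]

variable [FiniteDimensional ℂ E]

theorem Rh_typeOneZero (p : M) (v w a b : E) :
    Rh g p (typeOneZero p v) (conjC (typeOneZero p w)) (typeOneZero p a)
        (conjC (typeOneZero p b)) =
      -mixedHessian (localMetric g p) (chartAt E p p) v w a b
        + 8 * hermForm (localMetric g p (chartAt E p p))
          (chernForm (localMetric g p) (chartAt E p p) v a)
          (chernForm (localMetric g p) (chartAt E p p) w b) := by
  have h1 := (isHermitianNear_localMetric g p).cext₄_curvature_chernForm v w a b
  refine Eq.trans ?_ h1
  have h2 : (fun u v w x : E => localMetric g p (chartAt E p p)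
      (curvatureOfForm (chernForm (localMetric g p)) (chartAt E p p) u v w) x) =
      chernCurvature g p := by
    funext u v w x
    exact (inner_eq_localMetric g p _ _).symm
  rw [h2]
  rfl

theorem R_typeOneZero (p : M) (v w a b : E) :
    R g p (typeOneZero p v) (conjC (typeOneZero p w)) (typeOneZero p a)
        (conjC (typeOneZero p b)) =
      -(1 / 2) * (mixedHessian (localMetric g p) (chartAt E p p) v b a w
          + mixedHessian (localMetric g p) (chartAt E p p) a w v b)
        + 2 * hermForm (localMetric g p (chartAt E p p))
          (chernForm (localMetric g p) (chartAt E p p) v a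
            + chernForm (localMetric g p) (chartAt E p p) a v)
          (chernForm (localMetric g p) (chartAt E p p) w b
            + chernForm (localMetric g p) (chartAt E p p) b w)
        - 8 * (hermForm (localMetric g p (chartAt E p p))
            (contorsion (localMetric g p) (chartAt E p p) w a)
            (contorsion (localMetric g p) (chartAt E p p) v b)
          + hermForm (localMetric g p (chartAt E p p))
            (contorsion (localMetric g p) (chartAt E p p) b v)
            (contorsion (localMetric g p) (chartAt E p p) a w)) := by
  have h1 := (isHermitianNear_localMetric g p).cext₄_curvature_leviCivitaForm v w a b
  refine Eq.trans ?_ h1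
  have h2 : (fun u v w x : E => localMetric g p (chartAt E p p)
      (curvatureOfForm (leviCivitaForm (localMetric g p)) (chartAt E p p) u v w) x) =
      riemannCurvature g p := by
    funext u v w x
    exact (inner_eq_localMetric g p _ _).symm
  rw [h2]
  rfl

theorem torsionCoeff_typeOneZero (p : M) (x y z : E) :
    torsionCoeff g p (typeOneZero p x) (typeOneZero p y) (typeOneZero p z) =
      2 * hermForm (localMetric g p (chartAt E p p))
        (torsionOfForm (chernForm (localMetric g p)) (chartAt E p p) y z) x := by
  have h := isHermitianNear_localMetric g p
  have hg := h.isHermitianInner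
  have h1 := cext₃_sub_conjC (mulI E) (fun u v w : E => localMetric g p (chartAt E p p)
    (torsionOfForm (chernForm (localMetric g p)) (chartAt E p p) u v) w)
    (fun u v w => by rw [h.torsionOfForm_neg_left, map_neg, neg_apply])
    (fun u v w => by rw [h.torsionOfForm_neg_right, map_neg, neg_apply]) y z x
  have h2 : (fun u v w : E => localMetric g p (chartAt E p p)
      (torsionOfForm (chernForm (localMetric g p)) (chartAt E p p) u v) w) =
      fun u v w : E => g.inner p (chernTorsion g p u v) w := by
    funext u v w
    exact (inner_eq_localMetric g p _ _).symm
  have h3 : cext₃ (fun u v w : TangentSpace 𝓘(ℝ, E) p => g.inner p (chernTorsion g p u v) w)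
      (typeOneZero p y) (typeOneZero p z) (conjC (typeOneZero p x)) = _ :=
    Eq.trans (by rw [h2]; rfl) h1
  rw [torsionCoeff, h3]
  simp only [h.torsionOfForm_mulI_left, h.torsionOfForm_mulI_right, hg.inv, hg.mulI_left,
    mulI_mulI, map_neg, neg_apply, hermForm]
  push_cast
  ring

/-- The contorsion is an adjoint of the torsion, so the frame vector `f` moves out of `T` into a
slot of its own, where Parseval's identity applies. -/
theorem torsionCoeff_typeOneZero_eq_contorsion (p : M) (x y f : E) :
    torsionCoeff g p (typeOneZero p y) (typeOneZero p f) (typeOneZero p x) =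
      -4 * hermForm (localMetric g p (chartAt E p p)) f
        (contorsion (localMetric g p) (chartAt E p p) x y) := by
  have h := isHermitianNear_localMetric g p
  rw [torsionCoeff_typeOneZero, hermForm, hermForm, ← h.contorsion_mulI_right,
    h.symm _ f, h.symm _ f, h.inner_contorsion, h.inner_contorsion]
  push_cast
  ring

/-- The Hessians match term by term; with `a = C(v,w)`, `b = C(w,v)` the rest is `4|a|² + 4|b|² -
2|a+b|² = 2|a-b|²`. -/
theorem half_Rh_add_Rh_sub_R (p : M) (v w : E) :
    1 / 2 * (Rh g p (typeOneZero p v) (conjC (typeOneZero p v)) (typeOneZero p w)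
            (conjC (typeOneZero p w))
        + Rh g p (typeOneZero p w) (conjC (typeOneZero p w)) (typeOneZero p v)
            (conjC (typeOneZero p v)))
      - R g p (typeOneZero p v) (conjC (typeOneZero p w)) (typeOneZero p w)
          (conjC (typeOneZero p v)) =
      2 * hermForm (localMetric g p (chartAt E p p))
          (torsionOfForm (chernForm (localMetric g p)) (chartAt E p p) v w)
          (torsionOfForm (chernForm (localMetric g p)) (chartAt E p p) v w)
        + 8 * (hermForm (localMetric g p (chartAt E p p))
            (contorsion (localMetric g p) (chartAt E p p) w w)
            (contorsion (localMetric g p) (chartAt E p p) v v)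
          + hermForm (localMetric g p (chartAt E p p))
            (contorsion (localMetric g p) (chartAt E p p) v v)
            (contorsion (localMetric g p) (chartAt E p p) w w)) := by
  simp only [Rh_typeOneZero, R_typeOneZero, torsionOfForm, IsHermitianInner.hermForm_add_left,
    IsHermitianInner.hermForm_add_right, IsHermitianInner.hermForm_sub_left,
    IsHermitianInner.hermForm_sub_right]
  ring

/-- Here the two Hessians in `R` are conjugate to each other, and `8 Re⟨a,b⟩ - 2|a+b|² = -2|a-b|²`.
-/
theorem re_Rh_sub_R (p : M) (v w : E) :
    ((Rh g p (typeOneZero p v) (conjC (typeOneZero p w)) (typeOneZero p w)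
            (conjC (typeOneZero p v))).re : ℂ)
      - R g p (typeOneZero p v) (conjC (typeOneZero p v)) (typeOneZero p w)
          (conjC (typeOneZero p w)) =
      8 * (hermForm (localMetric g p (chartAt E p p))
            (contorsion (localMetric g p) (chartAt E p p) v w)
            (contorsion (localMetric g p) (chartAt E p p) v w)
          + hermForm (localMetric g p (chartAt E p p))
            (contorsion (localMetric g p) (chartAt E p p) w v)
            (contorsion (localMetric g p) (chartAt E p p) w v))
        - 2 * hermForm (localMetric g p (chartAt E p p))
          (torsionOfForm (chernForm (localMetric g p)) (chartAt E p p) v w)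
          (torsionOfForm (chernForm (localMetric g p)) (chartAt E p p) v w) := by
  have h := isHermitianNear_localMetric g p
  have h8 : starRingEnd ℂ 8 = 8 := Complex.conj_ofNat 8
  rw [Complex.re_eq_add_conj]
  simp only [Rh_typeOneZero, R_typeOneZero, torsionOfForm, IsHermitianInner.hermForm_add_left,
    IsHermitianInner.hermForm_add_right, IsHermitianInner.hermForm_sub_left,
    IsHermitianInner.hermForm_sub_right, map_add, map_neg, map_mul, h.conj_mixedHessian,
    h.isHermitianInner.conj_hermForm, h8]
  ring

theorem Rh_sub_R_self (p : M) (v : E) :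
    Rh g p (typeOneZero p v) (conjC (typeOneZero p v)) (typeOneZero p v)
            (conjC (typeOneZero p v))
      - R g p (typeOneZero p v) (conjC (typeOneZero p v)) (typeOneZero p v)
          (conjC (typeOneZero p v)) =
      16 * hermForm (localMetric g p (chartAt E p p))
        (contorsion (localMetric g p) (chartAt E p p) v v)
        (contorsion (localMetric g p) (chartAt E p p) v v) := by
  simp only [Rh_typeOneZero, R_typeOneZero, IsHermitianInner.hermForm_add_left,
    IsHermitianInner.hermForm_add_right]
  ring

theorem torsionOfForm_eq_zero_of_contorsion_self {G : E → E →L[ℝ] E →L[ℝ] ℝ} {z₀ : E}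
    (h : IsHermitianNear G z₀) (hP : ∀ v, contorsion G z₀ v v = 0) (u v : E) :
    torsionOfForm (chernForm G) z₀ u v = 0 := by
  have hadd : ∀ u v w : E, torsionOfForm (chernForm G) z₀ u (v + w) =
      torsionOfForm (chernForm G) z₀ u v + torsionOfForm (chernForm G) z₀ u w := by
    intro u v w
    refine h.isHermitianInner.ext_inner fun x => ?_
    simp only [torsionOfForm, map_add, map_sub, add_apply, sub_apply, h.inner_chernForm]
    ring
  have hdiag : ∀ x v, G z₀ (torsionOfForm (chernForm G) z₀ x v) v = 0 := by
    intro x v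
    have := h.inner_contorsion v v x
    rw [hP, map_zero, zero_apply] at this
    linarith
  have hskew : ∀ x v w, G z₀ (torsionOfForm (chernForm G) z₀ x v) w =
      -G z₀ (torsionOfForm (chernForm G) z₀ x w) v := by
    intro x v w
    have := hdiag x (v + w)
    rw [hadd, map_add, map_add, add_apply, add_apply, hdiag, hdiag] at this
    linarith
  refine h.isHermitianInner.ext_inner fun x => ?_
  have h1 := hskew u v x
  -- By complex bilinearity this reads `G(T(u,v),x) = +G(T(u,x),v)`, opposite in sign to `h1`.
  have h2 := hskew (mulI E u) v (mulI E x)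
  rw [h.torsionOfForm_mulI_left, h.torsionOfForm_mulI_left, h.torsionOfForm_mulI_right,
    mulI_mulI, h.isHermitianInner.inv, map_neg, neg_apply, neg_neg] at h2
  rw [map_zero, zero_apply]
  linarith

theorem isKahler_iff_chernTorsion_eq_zero :
    IsKahler g ↔ ∀ (p : M) (u v : TangentSpace 𝓘(ℝ, E) p), chernTorsion g p u v = 0 := by
  rw [isKahler_iff_fderiv]
  constructor
  · intro hK p (u : E) (v : E)
    have h := isHermitianNear_localMetric g p
    refine h.isHermitianInner.ext_inner fun x => ?_
    -- In the difference of these two instances of `dω = 0` the derivatives along `J x` cancel,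
    -- leaving `2 G(T(u,v),x)`.
    have h1 := hK p u v (mulI E x)
    have h2 := hK p (mulI E u) (mulI E v) (mulI E x)
    simp only [mulI_mulI, h.fderiv_mulI_left, map_neg, neg_apply] at h1 h2
    rw [h.fderiv_symm (mulI E v) x (mulI E u), h.fderiv_mulI_left] at h2
    rw [h.fderiv_symm v x u] at h1
    change localMetric g p _ (torsionOfForm _ _ u v) x = localMetric g p _ 0 x
    rw [map_zero, zero_apply, torsionOfForm, map_sub, sub_apply, h.inner_chernForm,
      h.inner_chernForm]
    linarith
  · intro hT p u v w
    have h := isHermitianNear_localMetric g p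
    -- In the cyclic sum of `G(T(u,v), J w)` the derivatives along `J u`, `J v`, `J w` cancel in
    -- pairs; what remains is `-dω(u,v,w)`.
    have key : ∀ a b c : E, localMetric g p (chartAt E p p)
        (torsionOfForm (chernForm (localMetric g p)) (chartAt E p p) a b) (mulI E c) = 0 := by
      intro a b c
      have : torsionOfForm (chernForm (localMetric g p)) (chartAt E p p) a b = 0 := hT p a b
      rw [this, map_zero, zero_apply]
    have h1 := key u v w
    have h2 := key v w u
    have h3 := key w u v
    simp only [torsionOfForm, map_sub, sub_apply, h.inner_chernForm, mulI_mulI, map_neg]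
      at h1 h2 h3
    rw [h.fderiv_symm (mulI E u) w v] at h3
    rw [h.fderiv_symm (mulI E v) w u] at h2
    rw [h.fderiv_symm (mulI E w) v u] at h2
    have e1 := h.fderiv_mulI_left u w v
    have e2 := h.fderiv_mulI_left v u w
    have e3 := h.fderiv_mulI_left w v u
    rw [h.fderiv_symm] at e1 e2 e3
    rw [h.fderiv_mulI_left, h.fderiv_mulI_left, h.fderiv_mulI_left]
    linarith

end Assembly

/-! ### Sums over a unitary frame and the equality case. -/

section UnitaryFrame

variable {E : Type*} [NormedAddCommGroup E] [NormedSpace ℂ E]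
  {M : Type*} [TopologicalSpace M] [ChartedSpace E M] [IsManifold 𝓘(ℂ, E) ∞ M]
  {g : HermitianMetric E M} {p : M}
  {e : Fin (Module.finrank ℂ E) → ℂ ⊗[ℝ] TangentSpace 𝓘(ℝ, E) p}

namespace IsUnitaryFrame

/-- The factor `1 / 2` arises because `f - √-1 J f` pairs with its conjugate to twice the Hermitian
norm of `f`. -/
theorem exists_real (he : IsUnitaryFrame g p e) : ∃ f : Fin (Module.finrank ℂ E) → E,
    (∀ k, e k = typeOneZero p (f k)) ∧
    ∀ i j, hermForm (localMetric g p (chartAt E p p)) (f i) (f j) =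
      if i = j then 1 / 2 else 0 := by
  choose f hf using fun k => (mem_T10_iff p (e k)).1 (he.mem k)
  refine ⟨f, hf, fun i j => ?_⟩
  have h1 := he.inner_eq i j
  rw [hf, hf, innerC_typeOneZero] at h1
  have h2 : hermForm (localMetric g p (chartAt E p p)) (f i) (f j) =
      1 / 2 * if i = j then 1 else 0 := by
    rw [← h1]
    ring
  rw [h2]
  split_ifs <;> simp

variable [FiniteDimensional ℂ E]

theorem sum_norm_sq_torsionCoeff (he : IsUnitaryFrame g p e) (x y : E) :
    ∑ k, ((‖torsionCoeff g p (e k) (typeOneZero p x) (typeOneZero p y)‖ : ℝ) : ℂ) ^ 2 =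
      2 * hermForm (localMetric g p (chartAt E p p))
        (torsionOfForm (chernForm (localMetric g p)) (chartAt E p p) x y)
        (torsionOfForm (chernForm (localMetric g p)) (chartAt E p p) x y) := by
  have hg := isHermitianInner_localMetric_self g p
  obtain ⟨f, hf, hff⟩ := he.exists_real
  have h1 := hg.sum_hermForm_mul_conj hff
    (torsionOfForm (chernForm (localMetric g p)) (chartAt E p p) x y)
    (torsionOfForm (chernForm (localMetric g p)) (chartAt E p p) x y)
  have h2 : starRingEnd ℂ 2 = 2 := Complex.conj_ofNat 2
  rw [show (2 : ℂ) = 4 * (1 / 2) by norm_num, mul_assoc, ← h1, Finset.mul_sum]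
  refine Finset.sum_congr rfl fun k _ => ?_
  rw [hf, torsionCoeff_typeOneZero, ← Complex.mul_conj', map_mul, h2, hg.conj_hermForm,
    hg.conj_hermForm]
  ring

theorem sum_torsionCoeff_mul_conj (he : IsUnitaryFrame g p e) (x x' y y' : E) :
    ∑ k, torsionCoeff g p (typeOneZero p y) (e k) (typeOneZero p x)
        * starRingEnd ℂ (torsionCoeff g p (typeOneZero p y') (e k) (typeOneZero p x')) =
      8 * hermForm (localMetric g p (chartAt E p p))
        (contorsion (localMetric g p) (chartAt E p p) x' y')
        (contorsion (localMetric g p) (chartAt E p p) x y) := by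
  have hg := isHermitianInner_localMetric_self g p
  obtain ⟨f, hf, hff⟩ := he.exists_real
  have h1 := hg.sum_hermForm_mul_conj hff
    (contorsion (localMetric g p) (chartAt E p p) x y)
    (contorsion (localMetric g p) (chartAt E p p) x' y')
  have h4 : starRingEnd ℂ (-4) = -4 := by
    rw [map_neg, Complex.conj_ofNat]
  rw [show (8 : ℂ) = 16 * (1 / 2) by norm_num, mul_assoc, ← h1, Finset.mul_sum]
  refine Finset.sum_congr rfl fun k _ => ?_
  rw [hf, torsionCoeff_typeOneZero_eq_contorsion, torsionCoeff_typeOneZero_eq_contorsion, map_mul,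
    h4]
  ring

end IsUnitaryFrame

variable [FiniteDimensional ℂ E]

theorem chernTorsion_eq_zero_of_Rh_eq_R (g : HermitianMetric E M)
    (hR : ∀ (p : M) (X : ℂ ⊗[ℝ] TangentSpace 𝓘(ℝ, E) p), X ∈ T10 p →
      Rh g p X (conjC X) X (conjC X) = R g p X (conjC X) X (conjC X))
    (p : M) (u v : TangentSpace 𝓘(ℝ, E) p) : chernTorsion g p u v = 0 := by
  have h := isHermitianNear_localMetric g p
  refine torsionOfForm_eq_zero_of_contorsion_self h (fun w => ?_) u v
  have h1 := Rh_sub_R_self g p w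
  rw [hR p _ ((mem_T10_iff p _).2 ⟨w, rfl⟩), sub_self, h.isHermitianInner.hermForm_self] at h1
  by_contra hne
  have h2 := h.pos _ hne
  have h3 : localMetric g p (chartAt E p p) (contorsion (localMetric g p) (chartAt E p p) w w)
      (contorsion (localMetric g p) (chartAt E p p) w w) = 0 := by
    have : (16 : ℂ) ≠ 0 := by norm_num
    exact_mod_cast (mul_eq_zero.1 h1.symm).resolve_left this
  exact h2.ne' h3

theorem Rh_eq_R_of_chernTorsion_eq_zero (g : HermitianMetric E M)
    (hT : ∀ (p : M) (u v : TangentSpace 𝓘(ℝ, E) p), chernTorsion g p u v = 0)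
    (p : M) (X : ℂ ⊗[ℝ] TangentSpace 𝓘(ℝ, E) p) (hX : X ∈ T10 p) :
    Rh g p X (conjC X) X (conjC X) = R g p X (conjC X) X (conjC X) := by
  have h := isHermitianNear_localMetric g p
  obtain ⟨v, rfl⟩ := (mem_T10_iff p X).1 hX
  have hP : contorsion (localMetric g p) (chartAt E p p) v v = 0 := by
    refine h.isHermitianInner.ext_inner fun x => ?_
    have : torsionOfForm (chernForm (localMetric g p)) (chartAt E p p) x v = 0 := hT p x v
    rw [h.inner_contorsion, this]
    simp
  have h1 := Rh_sub_R_self g p v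
  rw [hP, h.isHermitianInner.hermForm_self] at h1
  rw [← sub_eq_zero, h1]
  simp

end UnitaryFrame

end HermitianGeometry

end

/-! ### The main theorem. -/

open HermitianGeometry in
theorem mainTheorem6 {E : Type*} [NormedAddCommGroup E] [NormedSpace ℂ E] [FiniteDimensional ℂ E]
    {M : Type*} [TopologicalSpace M] [ChartedSpace E M] [IsManifold 𝓘(ℂ, E) ∞ M]
    (g : HermitianMetric E M) :
    (∀ (p : M) (X Y : ℂ ⊗[ℝ] TangentSpace 𝓘(ℝ, E) p), X ∈ T10 p → Y ∈ T10 p →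
      ∀ e : Fin (Module.finrank ℂ E) → ℂ ⊗[ℝ] TangentSpace 𝓘(ℝ, E) p, IsUnitaryFrame g p e →
        (1 / 2 * (Rh g p X (conjC X) Y (conjC Y) + Rh g p Y (conjC Y) X (conjC X))
            - R g p X (conjC Y) Y (conjC X)
          = ((∑ k, (‖torsionCoeff g p (e k) X Y‖ ^ 2
              + 2 * (torsionCoeff g p Y (e k) Y
                * starRingEnd ℂ (torsionCoeff g p X (e k) X)).re) : ℝ) : ℂ)) ∧
        (((Rh g p X (conjC Y) Y (conjC X)).re : ℂ) - R g p X (conjC X) Y (conjC Y)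
          = ((∑ k, (‖torsionCoeff g p Y (e k) X‖ ^ 2 + ‖torsionCoeff g p X (e k) Y‖ ^ 2
              - ‖torsionCoeff g p (e k) X Y‖ ^ 2) : ℝ) : ℂ)) ∧
        (Rh g p X (conjC X) X (conjC X) - R g p X (conjC X) X (conjC X)
          = ((2 * ∑ k, ‖torsionCoeff g p X (e k) X‖ ^ 2 : ℝ) : ℂ)) ∧
        0 ≤ 2 * ∑ k, ‖torsionCoeff g p X (e k) X‖ ^ 2) ∧
    ((∀ (p : M) (X : ℂ ⊗[ℝ] TangentSpace 𝓘(ℝ, E) p), X ∈ T10 p →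
        Rh g p X (conjC X) X (conjC X) = R g p X (conjC X) X (conjC X)) →
      ∀ (p : M) (u v : TangentSpace 𝓘(ℝ, E) p), chernTorsion g p u v = 0) ∧
    ((∀ (p : M) (X : ℂ ⊗[ℝ] TangentSpace 𝓘(ℝ, E) p), X ∈ T10 p →
        Rh g p X (conjC X) X (conjC X) = R g p X (conjC X) X (conjC X)) ↔ IsKahler g) := by
  refine ⟨fun p X Y hX hY e he => ?_, chernTorsion_eq_zero_of_Rh_eq_R g, ?_⟩
  · obtain ⟨v, rfl⟩ := (mem_T10_iff p X).1 hX
    obtain ⟨w, rfl⟩ := (mem_T10_iff p Y).1 hY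
    -- Splits the real part into two sums, each of the form evaluated by
    -- `sum_torsionCoeff_mul_conj`.
    have hre : ∀ z : ℂ, ((2 * z.re : ℝ) : ℂ) = z + starRingEnd ℂ z := fun z =>
      (Complex.add_conj z).symm
    refine ⟨?_, ?_, ?_, by positivity⟩
    · rw [half_Rh_add_Rh_sub_R, Complex.ofReal_sum]
      simp only [Complex.ofReal_add, Complex.ofReal_pow, hre, Finset.sum_add_distrib, map_mul,
        Complex.conj_conj]
      simp only [mul_comm (starRingEnd ℂ _), he.sum_norm_sq_torsionCoeff,
        he.sum_torsionCoeff_mul_conj]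
      ring
    · rw [re_Rh_sub_R, Complex.ofReal_sum]
      simp only [Complex.ofReal_add, Complex.ofReal_sub, Complex.ofReal_pow,
        Finset.sum_add_distrib, Finset.sum_sub_distrib, he.sum_norm_sq_torsionCoeff]
      simp only [← Complex.mul_conj', he.sum_torsionCoeff_mul_conj]
      ring
    · rw [Rh_sub_R_self, Complex.ofReal_mul, Complex.ofReal_sum]
      simp only [Complex.ofReal_pow]
      simp only [← Complex.mul_conj', he.sum_torsionCoeff_mul_conj]
      push_cast
      ring
  · rw [isKahler_iff_chernTorsion_eq_zero]
    exact ⟨chernTorsion_eq_zero_of_Rh_eq_R g, Rh_eq_R_of_chernTorsion_eq_zero g⟩
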